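/- Let $G$ be a simply connected real Lie group of dimension $3$ whose Lie algebra $\mathfrak g$ is of type $\mathfrak g_{3,3}$, and let $(E_1,E_2,E_3)$ be an ordered basis of $\mathfrak g$ with $$[E_1,E_2]=0,\qquad [E_3,E_1]=E_1,\qquad [E_2,E_3]=-E_2 .$$ For a linear map $\delta:\mathfrak g\to\mathfrak g$ write $\delta(E_j)=x_jE_1+y_jE_2+z_jE_3$ for $j=1,2,3$, so that its matrix has rows $(x_1,x_2,x_3)$, $(y_1,y_2,y_3)$, $(z_1,z_2,z_3)$. (1) $\delta$ is a derivation of $\mathfrak g$ if and only if the last row of its matrix is zero, $z_1=z_2=z_3=0$. The complex eigenvalues of a derivation, counted with multiplicity, are $$0,\qquad \tfrac12\Bigl(x_1+y_2\pm\sqrt{(x_1-y_2)^2+4x_2y_1}\Bigr).$$ (2) Let $\mathcal X$ be a linear vector field on $G$, that is, a smooth vector field whose flow $(\varphi_t)_{t\in\mathbb R}$ consists of Lie group automorphisms of $G$, and let $\mathcal D(Y)=-[\mathcal X,Y]$, $Y\in\mathfrak g$, be the associated derivation, with matrix entries $x_j,y_j,z_j$ as above. Then the last row of the matrix of $\mathcal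 D$ is zero. If moreover $$x_1+y_2=0\qquad\text{and}\qquad (x_1-y_2)^2+4x_2y_1<0,$$ then all nonzero eigenvalues of $\mathcal D$ are purely imaginary, and the linear flow $\varphi_t$ has a periodic orbit: there are $g\in G$, not a fixed point of the flow, and $T>0$ such that $\varphi_{t+T}(g)=\varphi_t(g)$ for all $t\in\mathbb R$. -/

import Mathlib

open scoped Manifold ContDiff

/-- `minSmoothness ℝ 3 = 3`, so a smooth real Lie group has a Lie algebra in Mathlib's sense. -/
instance instLEInftyMinSmoothnessRealThree : ENat.LEInfty (minSmoothness ℝ 3) :=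
  ⟨by
    rw [minSmoothness_of_isRCLikeNormedField]
    exact WithTop.coe_le_coe.2 le_top⟩

section LieAlgebraType

variable {L : Type*} [LieRing L] [LieAlgebra ℝ L]

/-- The ordered basis `(E₁, E₂, E₃) = (b 0, b 1, b 2)` of a real Lie algebra satisfies
`[E₁, E₂] = n₃ E₃`, `[E₃, E₁] = a E₁ + n₂ E₂`, `[E₂, E₃] = n₁ E₁ - a E₂`. -/
def HasStructureConstants (b : Module.Basis (Fin 3) ℝ L) (a n₁ n₂ n₃ : ℝ) : Prop :=
  ⁅b 0, b 1⁆ = n₃ • b 2 ∧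
  ⁅b 2, b 0⁆ = a • b 0 + n₂ • b 1 ∧
  ⁅b 1, b 2⁆ = n₁ • b 0 - a • b 1

/-- An ordered basis that exhibits a real Lie algebra as one of type `𝔤_{3,3}`:
`a = 1` and `n₁ = n₂ = n₃ = 0`. -/
def IsBasisOfTypeG33 (b : Module.Basis (Fin 3) ℝ L) : Prop :=
  HasStructureConstants b 1 0 0 0

end LieAlgebraType

section LinearFlow

variable {E : Type*} [NormedAddCommGroup E] [NormedSpace ℝ E] [CompleteSpace E]
  {H : Type*} [TopologicalSpace H] (I : ModelWithCorners ℝ E H)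
  {G : Type*} [TopologicalSpace G] [ChartedSpace H G] [Group G]

/-- A Lie group automorphism: a group automorphism that is smooth with smooth inverse. -/
def IsLieGroupAutomorphism (f : G → G) : Prop :=
  ∃ F : G ≃* G, (∀ g, F g = f g) ∧ ContMDiff I I ∞ F ∧ ContMDiff I I ∞ F.symm

/-- `𝒳` is a linear vector field on `G` and `φ` is its flow: `𝒳` is smooth, `t ↦ φ t g` is the
integral curve of `𝒳` starting at `g`, and every `φ t` is an automorphism of the Lie group `G`. -/
structure IsLinearFlow [LieGroup I ∞ G] (𝒳 : (g : G) → TangentSpace I g)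
    (φ : ℝ → G → G) : Prop where
  smooth : ContMDiff I I.tangent ∞ (fun g : G => (⟨g, 𝒳 g⟩ : TangentBundle I G))
  flow_zero : ∀ g, φ 0 g = g
  isMIntegralCurve : ∀ g, IsMIntegralCurve (I := I) (fun t => φ t g) 𝒳
  automorphism : ∀ t, IsLieGroupAutomorphism I (φ t)

/-- The linear map `Y ↦ -[𝒳, Y]` on the Lie algebra of `G`: an element of the Lie algebra is
identified with the left invariant vector field `Y`, and `-[𝒳, Y]` with its value at `1`. -/
noncomputable def associatedDerivation [LieGroup I ∞ G] (𝒳 : (g : G) → TangentSpace I g) :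
    GroupLieAlgebra I G →ₗ[ℝ] GroupLieAlgebra I G where
  toFun Y := -VectorField.mlieBracket I 𝒳 (mulInvariantVectorField Y) (1 : G)
  map_add' Y Z := by
    rw [mulInvariantVectorField_add, VectorField.mlieBracket_add_right
      (mdifferentiableAt_mulInvariantVectorField _) (mdifferentiableAt_mulInvariantVectorField _)]
    exact neg_add _ _
  map_smul' c Y := by
    rw [mulInvariantVectorField_smul, VectorField.mlieBracket_const_smul_right
      (mdifferentiableAt_mulInvariantVectorField _)]
    exact (smul_neg _ _).symm

end LinearFlow

/-- The flow `φ` has a periodic orbit: the orbit of some `g` that is not a fixed point is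
periodic with some period `T > 0`. -/
def HasPeriodicOrbit {G : Type*} (φ : ℝ → G → G) : Prop :=
  ∃ g : G, (∃ t, φ t g ≠ g) ∧ ∃ T : ℝ, 0 < T ∧ ∀ t, φ (t + T) g = φ t g

/-! Let `c = b.coord 2`. In type `𝔤_{3,3}` the bracket is `⁅x, y⁆ = c x • y - c y • x`
(`IsBasisOfTypeG33.lie_eq`). The Leibniz rule for `δ` then reduces to `c (δ x) • y = c (δ y) • x`
for all `x`, `y`, which forces `c ∘ δ = 0`; this is the vanishing of the last row. The eigenvalues
are read off the resulting block triangular matrix.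

For a linear flow, `1` is a zero of `𝒳`. Let `D` be the linearization there. Then `-[𝒳, Y]` at `1`
is `D` applied to `Y` at `1`, and the differential of `φ t` at `1` is `exp (t • D)` for `t ≥ 0`
(`IsLinearFlow.hasMFDerivAt_exp`). These exponentials preserve the bracket, hence preserve `c`
(`IsBasisOfTypeG33.coord_two_map`); differentiating at `t = 0` gives `c ∘ D = 0`, with no need to
check the Leibniz rule for `D`.

With zero trace and negative discriminant, `D³ = -w² D` for some `w > 0`, so `exp (T • D) = 1` for
`T = 2π / w`. An endomorphism of a connected Lie group with identity differential at `1` is the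
identity (`eq_id_of_hasMFDerivAt_one_id`), so `φ T = id` and every orbit closes up. Not every point
is fixed, since otherwise `D = 0` and the discriminant would vanish. -/

/-! ### Differentiating a local flow at an equilibrium of a vector field. -/

section LinearizedFlow

open Set Filter Topology Metric
open scoped NNReal

variable {E : Type*} [NormedAddCommGroup E] [NormedSpace ℝ E] [CompleteSpace E]

theorem hasDerivAt_exp_smul_apply (L : E →L[ℝ] E) (v : E) (t : ℝ) :
    HasDerivAt (fun s : ℝ => NormedSpace.exp (s • L) v)
      (L (NormedSpace.exp (t • L) v)) t := by
  have h := (hasDerivAt_exp_smul_const' (𝕂 := ℝ) L t).clm_apply (hasDerivAt_const t v)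
  simpa using h

/-- A differentiable vector field vanishing at `x₀` has local trajectories that depend
differentiably on the starting point at `x₀`, with derivative the exponential of the
linearization. -/
theorem hasFDerivAt_flow_of_trajectories {F : E → E} {x₀ : E} {L : E →L[ℝ] E}
    (hF : HasFDerivAt F L x₀) (h0 : F x₀ = 0) {K : ℝ≥0} {s : Set E}
    (hs : s ∈ 𝓝 x₀) (hK : LipschitzOnWith K F s) {r t : ℝ} (hr : 0 < r) (ht : 0 ≤ t)
    {α : E → ℝ → E} (hα0 : ∀ x ∈ ball x₀ r, α x 0 = x)
    (hα : ∀ x ∈ ball x₀ r, ∀ τ ∈ Icc 0 t, HasDerivAt (α x) (F (α x τ)) τ ∧ α x τ ∈ s) :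
    HasFDerivAt (fun x => α x t) (NormedSpace.exp (t • L)) x₀ := by
  have hx₀ : x₀ ∈ s := mem_of_mem_nhds hs
  have hcont : ∀ x ∈ ball x₀ r, ContinuousOn (α x) (Icc 0 t) := fun x hx τ hτ =>
    (hα x hx τ hτ).1.continuousAt.continuousWithinAt
  set C : ℝ := Real.exp (K * t) with hC
  have hCpos : 0 < C := Real.exp_pos _
  -- Grönwall comparison with the constant trajectory at the equilibrium `x₀`.
  have hgrow : ∀ x ∈ ball x₀ r, ∀ τ ∈ Icc 0 t, ‖α x τ - x₀‖ ≤ C * ‖x - x₀‖ := by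
    intro x hx τ hτ
    have := dist_le_of_trajectories_ODE_of_mem (v := fun _ => F) (s := fun _ => s) (K := K)
      (f := α x) (g := fun _ => x₀) (a := 0) (b := t) (δ := ‖x - x₀‖)
      (fun _ _ => hK) (hcont x hx)
      (fun σ hσ => (hα x hx σ (Ico_subset_Icc_self hσ)).1.hasDerivWithinAt)
      (fun σ hσ => (hα x hx σ (Ico_subset_Icc_self hσ)).2)
      continuousOn_const
      (fun σ _ => by simpa [h0] using (hasDerivWithinAt_const σ (Ici σ) x₀))
      (fun _ _ => hx₀) (by rw [hα0 x hx, dist_eq_norm]) τ hτ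
    rw [dist_eq_norm, sub_zero] at this
    refine this.trans ?_
    rw [mul_comm]
    exact mul_le_mul_of_nonneg_right
      (Real.exp_le_exp.2 (mul_le_mul_of_nonneg_left hτ.2 K.2)) (norm_nonneg _)
  set B : ℝ := gronwallBound 0 ‖L‖ 1 t with hB
  have hBmono := gronwallBound_mono (δ := 0) (K := ‖L‖) (ε := 1) le_rfl zero_le_one (norm_nonneg L)
  have hB0 : 0 ≤ B := by
    have := hBmono ht
    rwa [gronwallBound_x0] at this
  rw [hasFDerivAt_iff_isLittleO, Asymptotics.isLittleO_iff]
  intro c hc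
  -- The factor `C` absorbs the growth of trajectories and `B + 1` the final Grönwall factor `B`;
  -- the `+ 1` keeps the denominator positive.
  have hc' : 0 < c / (C * (B + 1)) := by positivity
  have hlin := (hasFDerivAt_iff_isLittleO.1 hF).def hc'
  obtain ⟨δ, hδ, hδF⟩ := Metric.eventually_nhds_iff_ball.1 hlin
  have hnear : ∀ᶠ x in 𝓝 x₀, x ∈ ball x₀ r ∧ x ∈ ball x₀ (δ / C) :=
    inter_mem (ball_mem_nhds _ hr) (ball_mem_nhds _ (by positivity))
  filter_upwards [hnear] with x hx
  obtain ⟨hxr, hxδ⟩ := hx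
  have hsmall : C * ‖x - x₀‖ < δ := by
    rw [mem_ball, dist_eq_norm, lt_div_iff₀ hCpos] at hxδ
    linarith
  have hx₀t : α x₀ t = x₀ := by
    have := hgrow x₀ (mem_ball_self hr) t ⟨ht, le_rfl⟩
    simpa [sub_eq_zero] using this
  set e : ℝ := c / (C * (B + 1)) * (C * ‖x - x₀‖) with he
  have hw : ∀ τ ∈ Icc 0 t, HasDerivAt
      (fun τ => α x τ - x₀ - NormedSpace.exp (τ • L) (x - x₀))
      (F (α x τ) - L (NormedSpace.exp (τ • L) (x - x₀))) τ := fun τ hτ =>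
    ((hα x hxr τ hτ).1.sub_const x₀).sub (hasDerivAt_exp_smul_apply L (x - x₀) τ)
  -- The error `w` starts at `0` and satisfies `w' = L w + R`, where the linearization remainder `R`
  -- has norm at most `e`.
  have key := norm_le_gronwallBound_of_norm_deriv_right_le (δ := 0) (K := ‖L‖) (ε := e)
    (a := 0) (b := t) (fun τ hτ => (hw τ hτ).continuousAt.continuousWithinAt)
    (fun τ hτ => (hw τ (Ico_subset_Icc_self hτ)).hasDerivWithinAt)
    (by simp [hα0 x hxr]) (fun τ hτ => by
      have hτ' := Ico_subset_Icc_self hτ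
      have h1 := hgrow x hxr τ hτ'
      have h2 := hδF (α x τ) (by rw [mem_ball, dist_eq_norm]; exact h1.trans_lt hsmall)
      rw [h0, sub_zero] at h2
      have h3 : F (α x τ) - L (NormedSpace.exp (τ • L) (x - x₀)) =
          L (α x τ - x₀ - NormedSpace.exp (τ • L) (x - x₀)) +
            (F (α x τ) - L (α x τ - x₀)) := by
        rw [map_sub L (α x τ - x₀)]; abel
      rw [h3]
      refine (norm_add_le _ _).trans (add_le_add (L.le_opNorm _) (h2.trans ?_))
      rw [he]
      gcongr) t ⟨ht, le_rfl⟩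
  have hscale : gronwallBound 0 ‖L‖ e t = e * B := by
    rw [hB]
    by_cases hL : ‖L‖ = 0
    · simp [gronwallBound, hL]
    · simp [gronwallBound, hL]; ring
  rw [sub_zero, hscale] at key
  rw [hx₀t]
  refine key.trans ?_
  rw [he]
  have : c / (C * (B + 1)) * (C * ‖x - x₀‖) * B = c * ‖x - x₀‖ * (B / (B + 1)) := by
    field_simp
  rw [this]
  refine mul_le_of_le_one_right (by positivity) ?_
  rw [div_le_one (by positivity)]
  linarith

/-- A `C¹` vector field vanishing at `x₀` has a local flow near `x₀`, staying in a prescribed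
neighbourhood, whose derivative at `x₀` is the exponential of the linearization. -/
theorem exists_flow_hasFDerivAt_exp {F : E → E} {x₀ : E} (hF : ContDiffAt ℝ 1 F x₀)
    (h0 : F x₀ = 0) {U : Set E} (hU : U ∈ 𝓝 x₀) :
    ∃ r > 0, ∃ ε > 0, ∃ α : E → ℝ → E,
      (∀ x ∈ ball x₀ r, α x 0 = x ∧
        ∀ t ∈ Ioo (-ε) ε, HasDerivAt (α x) (F (α x t)) t ∧ α x t ∈ U) ∧
      ∀ t ∈ Ico 0 ε, HasFDerivAt (fun x => α x t) (NormedSpace.exp (t • fderiv ℝ F x₀)) x₀ := by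
  obtain ⟨K, s, hs, hK⟩ := hF.exists_lipschitzOnWith
  obtain ⟨ε, hε, a, r, _, _, hr, hpl⟩ := IsPicardLindelof.of_contDiffAt_one hF
  obtain ⟨α, hα, hcont⟩ := (hpl 0).exists_forall_mem_closedBall_eq_hasDerivWithinAt_continuousOn
  simp only [zero_sub, zero_add] at hα hcont
  have hmem : closedBall x₀ (r : ℝ) ×ˢ Icc (-ε) ε ∈ 𝓝 (x₀, (0 : ℝ)) :=
    prod_mem_nhds (closedBall_mem_nhds _ hr) (Icc_mem_nhds (by linarith) hε)
  have hca := hcont.continuousAt hmem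
  have hα00 : α (x₀, 0) = x₀ := (hα x₀ (mem_closedBall_self r.2)).1
  have hev : ∀ᶠ q in 𝓝 (x₀, (0 : ℝ)), α q ∈ s ∩ U := by
    apply hca
    rw [hα00]
    exact inter_mem hs hU
  -- Joint continuity of the local flow gives one box of starting points and times on which
  -- trajectories stay in `s ∩ U`.
  obtain ⟨ρ, hρ, hball⟩ := Metric.eventually_nhds_iff_ball.1 (hev.and hmem)
  rw [← ball_prod_same] at hball
  have main : ∀ x ∈ ball x₀ ρ, ∀ t ∈ Ioo (-(min ρ ε)) (min ρ ε),
      HasDerivAt (fun t => α (x, t)) (F (α (x, t))) t ∧ α (x, t) ∈ s ∩ U := by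
    intro x hx t ht
    have htρ : t ∈ ball (0 : ℝ) ρ := by
      rw [mem_ball_zero_iff, Real.norm_eq_abs, abs_lt]
      constructor <;> linarith [ht.1, ht.2, min_le_left ρ ε]
    have hb := hball (x, t) ⟨hx, htρ⟩
    refine ⟨((hα x hb.2.1).2 t hb.2.2).hasDerivAt (Icc_mem_nhds ?_ ?_), hb.1⟩ <;>
    linarith [ht.1, ht.2, min_le_right ρ ε]
  have hzero : ∀ x ∈ ball x₀ ρ, α (x, 0) = x := fun x hx =>
    (hα x (hball (x, 0) ⟨hx, mem_ball_self hρ⟩).2.1).1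
  refine ⟨ρ, hρ, min ρ ε, lt_min hρ hε, fun x t => α (x, t), fun x hx => ⟨hzero x hx,
    fun t ht => ⟨(main x hx t ht).1, (main x hx t ht).2.2⟩⟩, fun t ht => ?_⟩
  refine hasFDerivAt_flow_of_trajectories (α := fun x t => α (x, t))
    (hF.differentiableAt one_ne_zero).hasFDerivAt h0 hs hK hρ ht.1 hzero fun x hx τ hτ => ?_
  have := main x hx τ ⟨by linarith [hτ.1, lt_min hρ hε], hτ.2.trans_lt ht.2⟩
  exact ⟨this.1, this.2.1⟩

end LinearizedFlow

/-! ### Flow and Lie bracket at a zero of a vector field on a manifold. -/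

section FlowAtFixedPoint

open Set Filter Topology Metric VectorField

variable {E : Type*} [NormedAddCommGroup E] [NormedSpace ℝ E]
  {H : Type*} [TopologicalSpace H] {I : ModelWithCorners ℝ E H}
  {M : Type*} [TopologicalSpace M] [ChartedSpace H M]

variable (I) in
/-- The expression of a vector field in the preferred chart at `p`. -/
noncomputable def chartVectorField (X : (x : M) → TangentSpace I x) (p : M) : E → E :=
  mpullbackWithin 𝓘(ℝ, E) I (extChartAt I p).symm X (range I)

theorem chartVectorField_self [IsManifold I 1 M] (X : (x : M) → TangentSpace I x) (p : M) :
    chartVectorField I X p (extChartAt I p p) = X p := by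
  -- Quantifying over `q = p` allows substitution although `X q` and `X p` lie in different tangent
  -- spaces.
  have h : ∀ q : M, q = p → ∀ A : E →L[ℝ] E, A = ContinuousLinearMap.id ℝ E →
      A.inverse (X q) = (X p : E) := by
    rintro q rfl A rfl
    rw [ContinuousLinearMap.inverse_id]
    rfl
  exact h _ (extChartAt_to_inv p) _ mfderivWithin_range_extChartAt_symm

theorem contDiffAt_chartVectorField [CompleteSpace E] [I.Boundaryless] [IsManifold I ∞ M]
    {X : (x : M) → TangentSpace I x}
    (hX : ContMDiff I I.tangent ∞ (fun x => (⟨x, X x⟩ : TangentBundle I M))) (p : M) :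
    ContDiffAt ℝ 1 (chartVectorField I X p) (extChartAt I p p) := by
  have : IsManifold I 1 M := IsManifold.of_le (n := ∞) (by simp)
  have : IsManifold I 2 M := IsManifold.of_le (n := ∞) (WithTop.coe_le_coe.2 le_top)
  have h := contMDiffWithinAt_mpullbackWithin_extChartAt_symm (I := I) (s := univ) (x := p)
    (m := 1) (n := 2) (V := X) ((hX p).of_le (by simp)).contMDiffWithinAt
    uniqueMDiffOn_univ (mem_univ _) (by norm_num)
  rw [contMDiffWithinAt_vectorSpace_iff_contDiffWithinAt, preimage_univ, inter_univ] at h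
  exact h.contDiffAt (extChartAt_target_mem_nhds p)

/-- The chart expression of `X` is built with the inverse of the differential of the inverse chart,
so pushing a chart solution forward by that differential recovers `X`. -/
theorem isMIntegralCurveOn_extChartAt_symm_comp [I.Boundaryless] [IsManifold I 1 M]
    {X : (x : M) → TangentSpace I x} {p : M} {β : ℝ → E} {s : Set ℝ}
    (hβ : ∀ t ∈ s, HasDerivAt β (chartVectorField I X p (β t)) t ∧
      β t ∈ (extChartAt I p).target) :
    IsMIntegralCurveOn (I := I) (fun t => (extChartAt I p).symm (β t)) X s := by
  intro t ht
  obtain ⟨h1, h2⟩ := hβ t ht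
  have h3 := mdifferentiableWithinAt_extChartAt_symm (I := I) h2
  have h4 := h1.hasFDerivAt.hasMFDerivAt.hasMFDerivWithinAt (s := s)
  have h5 := HasMFDerivWithinAt.comp t h3.hasMFDerivWithinAt h4 (by simp [I.range_eq_univ])
  refine h5.congr_mfderiv ?_
  have hinv := isInvertible_mfderivWithin_extChartAt_symm (I := I) h2
  have key : ∀ A : E →L[ℝ] E, A.IsInvertible → ∀ v : E,
      A.comp ((ContinuousLinearMap.toSpanSingleton ℝ (A.inverse v))) =
        (1 : ℝ →L[ℝ] ℝ).smulRight v := by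
    rintro _ ⟨A, rfl⟩ v
    ext
    simp
  exact key _ hinv _

/-- Near a zero `p` of a smooth vector field, the time `t` flow has for small `t ≥ 0` a derivative
at `p` that is the exponential of the linearization of the vector field. -/
theorem hasMFDerivAt_flow_of_eq_zero [CompleteSpace E] [I.Boundaryless] [IsManifold I ∞ M]
    [T2Space M] {X : (x : M) → TangentSpace I x}
    (hX : ContMDiff I I.tangent ∞ (fun x => (⟨x, X x⟩ : TangentBundle I M)))
    {φ : ℝ → M → M} (hφ0 : ∀ q, φ 0 q = q)
    (hφ : ∀ q, IsMIntegralCurve (I := I) (fun t => φ t q) X)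
    (hφc : ∀ t, Continuous (φ t)) {p : M} (hp : X p = 0) (hφp : ∀ t, φ t p = p) :
    ∃ ε > 0, ∀ t ∈ Ico 0 ε, HasMFDerivAt I I (φ t) p
      (NormedSpace.exp (t • fderiv ℝ (chartVectorField I X p) (extChartAt I p p)) : E →L[ℝ] E) := by
  have : IsManifold I 1 M := IsManifold.of_le (n := ∞) (by simp)
  obtain ⟨r, hr, ε, hε, α, hα, hαd⟩ := exists_flow_hasFDerivAt_exp
    (contDiffAt_chartVectorField hX p) ((chartVectorField_self X p).trans hp)
    (extChartAt_target_mem_nhds (I := I) p)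
  refine ⟨ε, hε, fun t ht => ⟨(hφc t).continuousAt, ?_⟩⟩
  have heq : ∀ x ∈ ball (extChartAt I p p) r, x ∈ (extChartAt I p).target →
      extChartAt I p (φ t ((extChartAt I p).symm x)) = α x t := by
    intro x hx hxt
    obtain ⟨hx0, hxα⟩ := hα x hx
    have ht' : t ∈ Ioo (-ε) ε := ⟨by linarith [ht.1], ht.2⟩
    -- Uniqueness of integral curves identifies the given flow with the local flow built in the
    -- chart.
    have huniq := isMIntegralCurveOn_Ioo_eqOn_of_contMDiff_boundaryless (I := I)
      (t₀ := 0) ⟨by linarith, hε⟩ (hX.of_le (by simp))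
      ((hφ ((extChartAt I p).symm x)).isMIntegralCurveOn (Ioo (-ε) ε))
      (isMIntegralCurveOn_extChartAt_symm_comp hxα) (by simp [hφ0, hx0])
    have := huniq ht'
    simp only at this
    rw [this, (extChartAt I p).right_inv (hxα t ht').2]
  have hw : writtenInExtChartAt I I p (φ t) =ᶠ[𝓝 (extChartAt I p p)] fun x => α x t := by
    filter_upwards [ball_mem_nhds _ hr, extChartAt_target_mem_nhds (I := I) p] with x hx hxt
    rw [writtenInExtChartAt, hφp]
    exact heq x hx hxt
  exact ((hαd t ht).congr_of_eventuallyEq hw).hasFDerivWithinAt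

/-- At a zero of a vector field, the Lie bracket only depends on its linearization. -/
theorem neg_mlieBracket_of_eq_zero [I.Boundaryless] [IsManifold I 1 M]
    {X Y : (x : M) → TangentSpace I x} {p : M} (hp : X p = 0) :
    -mlieBracket I X Y p =
      fderiv ℝ (chartVectorField I X p) (extChartAt I p p) (Y p) := by
  have h : mlieBracket I X Y p = (mfderiv I 𝓘(ℝ, E) (extChartAt I p) p).inverse
      (lieBracketWithin (E := E) ℝ (chartVectorField I X p) (chartVectorField I Y p)
        ((extChartAt I p).symm ⁻¹' univ ∩ range I) (extChartAt I p p)) := rfl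
  have key : ∀ A : E →L[ℝ] E, A = ContinuousLinearMap.id ℝ E → ∀ v : E, A.inverse v = v := by
    rintro _ rfl v
    simp
  have h2 := h.trans (key _ mfderiv_extChartAt_self _)
  rw [preimage_univ, univ_inter, I.range_eq_univ, lieBracketWithin_univ, lieBracket,
    chartVectorField_self, chartVectorField_self, hp] at h2
  -- Here `a` is the derivative of `Y` applied to `X p = 0`; only the term differentiating `X`
  -- survives.
  have h3 : ∀ z a b : E, a = 0 → z = a - b → -z = b := by
    rintro _ _ b rfl rfl
    simp
  exact h3 _ _ _ ((fderiv ℝ (chartVectorField I Y p) (extChartAt I p p)).map_zero) h2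

end FlowAtFixedPoint

/-! ### Maps with zero differential. -/

section LocallyConstant

open Set Filter Topology Metric

variable {E : Type*} [NormedAddCommGroup E] [NormedSpace ℝ E]
  {H : Type*} [TopologicalSpace H] {I : ModelWithCorners ℝ E H}
  {M : Type*} [TopologicalSpace M] [ChartedSpace H M]
  {E' : Type*} [NormedAddCommGroup E'] [NormedSpace ℝ E']
  {H' : Type*} [TopologicalSpace H'] {I' : ModelWithCorners ℝ E' H'}
  {N : Type*} [TopologicalSpace N] [ChartedSpace H' N]

/-- A map between manifolds whose derivative vanishes everywhere is locally constant. -/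
theorem isLocallyConstant_of_hasMFDerivAt_zero [I.Boundaryless] [IsManifold I 1 M]
    [IsManifold I' 1 N] {f : M → N}
    (hf : ∀ x, HasMFDerivAt I I' f x (0 : E →L[ℝ] E')) : IsLocallyConstant f := by
  rw [IsLocallyConstant.iff_eventually_eq]
  intro p
  have hcont : Continuous f := continuous_iff_continuousAt.2 fun x => (hf x).1
  set c := extChartAt I p with hc
  set d := extChartAt I' (f p) with hd
  have hopen : (c.target ∩ c.symm ⁻¹' (f ⁻¹' d.source)) ∈ 𝓝 (c p) := by
    refine inter_mem (extChartAt_target_mem_nhds p) ?_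
    have h1 : ContinuousAt (fun y => f (c.symm y)) (c p) :=
      hcont.continuousAt.comp (continuousAt_extChartAt_symm p)
    refine h1.preimage_mem_nhds ?_
    rw [hc, extChartAt_to_inv]
    exact extChartAt_source_mem_nhds (f p)
  obtain ⟨r, hr, hball⟩ := Metric.mem_nhds_iff.1 hopen
  have hderiv : ∀ y ∈ ball (c p) r, HasFDerivAt (fun y => d (f (c.symm y))) (0 : E →L[ℝ] E') y := by
    intro y hy
    obtain ⟨hyt, hys⟩ := hball hy
    have h1 := (mdifferentiableWithinAt_extChartAt_symm (I := I) hyt)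
    rw [I.range_eq_univ, mdifferentiableWithinAt_univ] at h1
    have h2 := (mdifferentiableAt_extChartAt (I := I') (x := f p) (y := f (c.symm y))
      (by simpa [hd] using hys)).hasMFDerivAt
    have h3 := (h2.comp _ ((hf (c.symm y)))).comp y h1.hasMFDerivAt
    have h4 : HasMFDerivAt 𝓘(ℝ, E) 𝓘(ℝ, E') (fun y => d (f (c.symm y))) y (0 : E →L[ℝ] E') := by
      refine h3.congr_mfderiv ?_
      have : ∀ (A : E' →L[ℝ] E') (B : E →L[ℝ] E), (A.comp (0 : E →L[ℝ] E')).comp B = 0 := by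
        intros; simp
      exact this _ _
    exact h4.hasFDerivAt
  have hcst : ∀ y ∈ ball (c p) r, d (f (c.symm y)) = d (f (c.symm (c p))) := by
    intro y hy
    exact (convex_ball (c p) r).is_const_of_fderivWithin_eq_zero (𝕜 := ℝ)
      (f := fun y => d (f (c.symm y)))
      (fun z hz => (hderiv z hz).differentiableAt.differentiableWithinAt)
      (fun z hz => (hderiv z hz).hasFDerivWithinAt.fderivWithin
        (isOpen_ball.uniqueDiffWithinAt hz)) hy (mem_ball_self hr)
  have hnear : ∀ᶠ q in 𝓝 p, q ∈ c.source ∧ c q ∈ ball (c p) r :=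
    inter_mem (extChartAt_source_mem_nhds (I := I) p)
      ((continuousAt_extChartAt (I := I) p).preimage_mem_nhds (ball_mem_nhds _ hr))
  filter_upwards [hnear] with q hq
  have h1 := hcst (c q) hq.2
  have h2 := (hball hq.2).2
  rw [mem_preimage, mem_preimage, c.left_inv hq.1] at h2
  rw [c.left_inv hq.1, hc, extChartAt_to_inv] at h1
  exact d.injOn h2 (mem_extChartAt_source _) h1

end LocallyConstant

/-! ### Lie group endomorphisms and their differential at the identity. -/

section LieGroupHom

open VectorField

variable {E : Type*} [NormedAddCommGroup E] [NormedSpace ℝ E]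
  {H : Type*} [TopologicalSpace H] {I : ModelWithCorners ℝ E H}
  {G : Type*} [TopologicalSpace G] [ChartedSpace H G] [Group G] [LieGroup I ∞ G]

theorem hasMFDerivAt_mul_left (g h : G) :
    HasMFDerivAt I I (g * ·) h (mfderiv I I (g * ·) h) :=
  ((contMDiff_mul_left (I := I) (n := ∞) (a := g)).mdifferentiable (by simp) h).hasMFDerivAt

/-- A smooth group endomorphism maps left invariant vector fields to left invariant ones. -/
theorem mfderiv_mulInvariantVectorField_of_map_mul {f : G → G} (hf : ContMDiff I I ∞ f)
    (hmul : ∀ g h, f (g * h) = f g * f h) {A : E →L[ℝ] E} (hA : HasMFDerivAt I I f 1 A)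
    (v : E) (g : G) :
    (mfderiv I I f g : E →L[ℝ] E) (mulInvariantVectorField (I := I) (G := G) v g : E) =
      mulInvariantVectorField (I := I) (G := G) (A v : E) (f g) := by
  have hf1 : f 1 = 1 := by simpa using hmul 1 1
  have h1 : ∀ y, y = g → HasMFDerivAt I I f y (mfderiv I I f g : E →L[ℝ] E) := by
    rintro _ rfl
    exact (hf.mdifferentiable (by simp) _).hasMFDerivAt
  have h2 := (h1 (g * 1) (mul_one g)).comp (1 : G) (hasMFDerivAt_mul_left (I := I) g 1)
  have h3 : ∀ y, y = (1 : G) →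
      HasMFDerivAt I I (f g * ·) y (mfderiv I I (f g * ·) (1 : G) : E →L[ℝ] E) := by
    rintro _ rfl
    exact hasMFDerivAt_mul_left (I := I) (f g) 1
  have h4 := (h3 (f 1) hf1).comp (1 : G) hA
  have h5 : f ∘ (g * ·) = (f g * ·) ∘ f := by
    ext x
    exact hmul g x
  rw [h5] at h2
  exact DFunLike.congr_fun (hasMFDerivAt_unique h2 h4) v

/-- The derivative at `1` of an automorphism of a Lie group preserves the Lie bracket. -/
theorem IsLieGroupAutomorphism.map_lie [CompleteSpace E] {f : G → G}
    (hf : IsLieGroupAutomorphism I f) {A : E →L[ℝ] E} (hA : HasMFDerivAt I I f 1 A)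
    (v w : GroupLieAlgebra I G) :
    A (⁅v, w⁆ : GroupLieAlgebra I G) =
      Bracket.bracket (L := GroupLieAlgebra I G) (M := GroupLieAlgebra I G) (A v) (A w) := by
  obtain ⟨F, hFf, hF, hF'⟩ := hf
  obtain rfl : ⇑F = f := funext hFf
  have hinv : ∀ g, (mfderiv I I F g).IsInvertible := by
    intro g
    have h1 := (hF.mdifferentiable (by simp) g).hasMFDerivAt
    have h2 := (hF'.mdifferentiable (by simp) (F g)).hasMFDerivAt
    have h3 : ∀ y, y = g → HasMFDerivAt I I F y (mfderiv I I F g : E →L[ℝ] E) := by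
      rintro _ rfl
      exact h1
    have h4 := h2.comp g h1
    have h5 := (h3 (F.symm (F g)) (F.symm_apply_apply g)).comp (F g) h2
    have e1 : F.symm ∘ F = id := by ext; simp
    have e2 : F ∘ F.symm = id := by ext; simp
    rw [e1] at h4
    rw [e2] at h5
    exact ContinuousLinearMap.IsInvertible.of_inverse
      (hasMFDerivAt_unique h5 (hasMFDerivAt_id _)) (hasMFDerivAt_unique h4 (hasMFDerivAt_id _))
  have hpull : ∀ v : E, mpullback I I F (mulInvariantVectorField (I := I) (G := G) (A v : E)) =
      mulInvariantVectorField (I := I) (G := G) v := by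
    intro v
    funext g
    have key : ∀ B : E →L[ℝ] E, B.IsInvertible → ∀ x y : E, B x = y → B.inverse y = x := by
      rintro _ ⟨B, rfl⟩ x _ rfl
      simp
    exact key _ (hinv g) _ _
      (mfderiv_mulInvariantVectorField_of_map_mul hF (map_mul F) hA v g)
  have hb := mpullback_mlieBracket (I := I) (I' := I) (n := ∞) (f := F) (x₀ := (1 : G))
    (V := mulInvariantVectorField (I := I) (G := G) (A v : E))
    (W := mulInvariantVectorField (I := I) (G := G) (A w : E))
    (mdifferentiableAt_mulInvariantVectorField _) (mdifferentiableAt_mulInvariantVectorField _)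
    (hF 1) (by rw [minSmoothness_of_isRCLikeNormedField]; exact WithTop.coe_le_coe.2 le_top)
  rw [hpull v, hpull w] at hb
  have hAeq : (mfderiv I I F (1 : G) : E →L[ℝ] E) = A := hA.mfderiv
  have key : ∀ B : E →L[ℝ] E, B.IsInvertible → ∀ x y z: E, z = y → B.inverse z = x → B x = y := by
    rintro _ ⟨B, rfl⟩ _ y _ rfl rfl
    simp
  have hz : ∀ p : G, p = 1 →
      (mlieBracket I (mulInvariantVectorField (I := I) (G := G) (A v : E))
        (mulInvariantVectorField (I := I) (G := G) (A w : E)) p : E) =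
      Bracket.bracket (L := GroupLieAlgebra I G) (M := GroupLieAlgebra I G) (A v) (A w) := by
    rintro _ rfl
    rfl
  exact (DFunLike.congr_fun hAeq _).symm.trans (key _ (hinv 1) _ _ _ (hz (F 1) (map_one F)) hb)

/-- A smooth group endomorphism of a connected Lie group is the identity if its derivative at `1`
is. -/
theorem eq_id_of_hasMFDerivAt_one_id [I.Boundaryless] [PreconnectedSpace G] {f : G → G}
    (hf : ContMDiff I I ∞ f) (hmul : ∀ g h, f (g * h) = f g * f h)
    (hid : HasMFDerivAt I I f 1 (ContinuousLinearMap.id ℝ E)) (g : G) : f g = g := by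
  have hM : IsManifold I 1 G := IsManifold.of_le (n := ∞) (by simp)
  have hf1 : f 1 = 1 := by simpa using hmul 1 1
  -- The deviation of `f` from the identity; it suffices that its differential vanishes everywhere.
  set h : G → G := fun g => f g * g⁻¹ with hh
  have hh1 : h 1 = 1 := by simp [hh, hf1]
  have hhs : ContMDiff I I ∞ h := hf.mul (contMDiff_inv I ∞)
  have hd1 : HasMFDerivAt I I h 1 (0 : E →L[ℝ] E) := by
    have h1 := (hhs.mdifferentiable (by simp) 1).hasMFDerivAt
    have h2 := h1.prodMk (hasMFDerivAt_id (1 : G))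
    have h3 := (contMDiff_mul I ∞ (G := G)).mdifferentiable (by simp) (h 1, 1)
    have h4 := HasMFDerivAt.comp (f := fun x => (h x, id x)) (1 : G) h3.hasMFDerivAt h2
    -- Differentiating `f x = h x * x` at `1` gives `D + id = id`, hence `D = 0`.
    have h5 : (fun p : G × G => p.1 * p.2) ∘ (fun x => (h x, id x)) = f := by
      ext x
      simp [hh]
    rw [h5] at h4
    have h6 := hasMFDerivAt_unique h4 hid
    set D : E →L[ℝ] E := mfderiv I I h (1 : G) with hD
    have h7 : ∀ v : E, (mfderiv (I.prod I) I (fun p : G × G => p.1 * p.2) (h 1, 1) :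
        E × E →L[ℝ] E) (D v, v) =
        (mfderiv I I (fun z : G => z * 1) (h 1) : E →L[ℝ] E) (D v) +
          (mfderiv I I (fun z : G => h 1 * z) 1 : E →L[ℝ] E) v := fun v =>
      mfderiv_prod_eq_add_apply (v := ((D v, v) : E × E)) h3
    have h8 : (mfderiv I I (fun z : G => z * 1) (h 1) : E →L[ℝ] E) =
        ContinuousLinearMap.id ℝ E := by
      have : (fun z : G => z * 1) = id := by ext; simp
      rw [this]
      exact mfderiv_id
    have h9 : (mfderiv I I (fun z : G => h 1 * z) (1 : G) : E →L[ℝ] E) =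
        ContinuousLinearMap.id ℝ E := by
      have : (fun z : G => h 1 * z) = id := by ext; simp [hh1]
      rw [this]
      exact mfderiv_id
    have h10 : ∀ v : E, D v + v = v := fun v => by
      have := (h7 v).symm.trans (DFunLike.congr_fun h6 v)
      rw [h8, h9] at this
      exact this
    have h11 : D = 0 := by
      ext v
      simpa using h10 v
    exact h1.congr_mfderiv h11
  have hd : ∀ g, HasMFDerivAt I I h g (0 : E →L[ℝ] E) := by
    intro g
    have h0 : ∀ y, y = (1 : G) → HasMFDerivAt I I h y (0 : E →L[ℝ] E) := by
      rintro _ rfl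
      exact hd1
    have h1 := (h0 (g⁻¹ * g) (inv_mul_cancel g)).comp g (hasMFDerivAt_mul_left (I := I) g⁻¹ g)
    have h2 : MDifferentiable I I fun x : G => f g * x * g⁻¹ :=
      ((contMDiff_mul_right (I := I) (n := ∞) (a := g⁻¹)).comp
        (contMDiff_mul_left (I := I) (n := ∞) (a := f g))).mdifferentiable (by simp)
    have h3 := (h2 _).hasMFDerivAt.comp g h1
    -- The identity `h x = f g * h (g⁻¹ * x) * g⁻¹` carries the vanishing of the differential from
    -- `1` to `g`.
    have h4 : (fun x : G => f g * x * g⁻¹) ∘ (h ∘ (g⁻¹ * ·)) = h := by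
      ext x
      have : f x = f g * f (g⁻¹ * x) := by rw [← hmul, mul_inv_cancel_left]
      simp [hh, this, mul_assoc]
    rw [h4] at h3
    refine h3.congr_mfderiv ?_
    have key : ∀ B C : E →L[ℝ] E, B.comp ((0 : E →L[ℝ] E).comp C) = 0 := by
      intros; simp
    exact key _ _
  have hconst := (isLocallyConstant_of_hasMFDerivAt_zero hd).apply_eq_of_preconnectedSpace g 1
  rw [hh1] at hconst
  exact mul_inv_eq_one.1 hconst

end LieGroupHom

/-! ### Derivations and automorphisms in type `𝔤_{3,3}`. -/

section LieAlgebraG33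

variable {L : Type*} [LieRing L] [LieAlgebra ℝ L] {b : Module.Basis (Fin 3) ℝ L}

/-- This basis-light form of the bracket turns each later computation into a symmetry condition on
one linear functional. -/
theorem IsBasisOfTypeG33.lie_eq (hb : IsBasisOfTypeG33 b) (x y : L) :
    ⁅x, y⁆ = b.coord 2 x • y - b.coord 2 y • x := by
  obtain ⟨h01, h20, h12⟩ := hb
  rw [zero_smul] at h01
  rw [one_smul, zero_smul, add_zero] at h20
  rw [zero_smul, one_smul, zero_sub] at h12
  have h10 : ⁅b 1, b 0⁆ = 0 := by rw [← lie_skew, h01, neg_zero]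
  have h02 : ⁅b 0, b 2⁆ = -b 0 := by rw [← lie_skew, h20]
  have h21 : ⁅b 2, b 1⁆ = b 1 := by rw [← lie_skew, h12, neg_neg]
  have hx := b.sum_repr x
  have hy := b.sum_repr y
  rw [Fin.sum_univ_three] at hx hy
  simp only [Module.Basis.coord_apply]
  generalize b.repr x = p at hx ⊢
  generalize b.repr y = q at hy ⊢
  rw [← hx, ← hy]
  simp only [lie_add, add_lie, lie_smul, smul_lie, lie_self, h01, h20, h12, h10, h02, h21]
  module

theorem Module.Basis.eq_zero_of_smul_comm (b : Module.Basis (Fin 3) ℝ L) {f : L →ₗ[ℝ] ℝ}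
    (hf : ∀ x y, f x • y = f y • x) : f = 0 := by
  refine b.ext fun j => ?_
  -- The index `j + 1`, taken modulo 3, serves only as one different from `j`; its coordinate
  -- isolates `f (b j)`.
  have h := congrArg (b.coord (j + 1)) (hf (b j) (b (j + 1)))
  have hj : j ≠ j + 1 := by fin_cases j <;> decide
  simpa [Finsupp.single_eq_of_ne hj, Finsupp.single_eq_of_ne hj.symm] using h

/-- In the Leibniz rule the terms `c x • δ y` and `c y • δ x` cancel, leaving `c (δ x) • y = c (δ y)
• x`. -/
theorem IsBasisOfTypeG33.exists_lieDerivation_iff (hb : IsBasisOfTypeG33 b) (δ : L →ₗ[ℝ] L) :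
    (∃ D : LieDerivation ℝ L L, D.toLinearMap = δ) ↔ b.coord 2 ∘ₗ δ = 0 := by
  constructor
  · rintro ⟨D, rfl⟩
    refine b.eq_zero_of_smul_comm fun x y => ?_
    have h := D.apply_lie_eq_sub x y
    simp only [hb.lie_eq, map_sub, map_smul] at h
    have h' : b.coord 2 (D x) • y - b.coord 2 (D y) • x = 0 := by
      linear_combination (norm := module) (-1 : ℝ) • h
    exact sub_eq_zero.1 h'
  · intro h
    have hz : ∀ x, b.coord 2 (δ x) = 0 := fun x => LinearMap.congr_fun h x
    refine ⟨⟨δ, fun x y => ?_⟩, rfl⟩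
    simp only [hb.lie_eq, map_sub, map_smul, hz, zero_smul, sub_zero]

/-- With `f = c - c ∘ A`, compatibility with brackets says `A (f x • y) = A (f y • x)`; injectivity
removes `A`, and then `f = 0`. -/
theorem IsBasisOfTypeG33.coord_two_map (hb : IsBasisOfTypeG33 b) {A : L →ₗ[ℝ] L}
    (hA : Function.Injective A) (hlie : ∀ x y, A ⁅x, y⁆ = ⁅A x, A y⁆) (x : L) :
    b.coord 2 (A x) = b.coord 2 x := by
  have h : b.coord 2 - b.coord 2 ∘ₗ A = 0 := by
    refine b.eq_zero_of_smul_comm fun x y => hA ?_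
    have h := hlie x y
    simp only [hb.lie_eq, map_sub, map_smul] at h
    simp only [LinearMap.sub_apply, LinearMap.comp_apply, map_sub, map_smul, sub_smul]
    linear_combination (norm := module) (1 : ℝ) • h
  exact (sub_eq_zero.1 (LinearMap.congr_fun h x)).symm

theorem Module.Basis.coord_comp_eq_zero_iff {M : Type*} [AddCommGroup M] [Module ℝ M]
    (b : Module.Basis (Fin 3) ℝ M) (δ : M →ₗ[ℝ] M) (i : Fin 3) :
    b.coord i ∘ₗ δ = 0 ↔ ∀ j, LinearMap.toMatrix b b δ i j = 0 := by
  simp only [LinearMap.toMatrix_apply]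
  exact ⟨fun h j => LinearMap.congr_fun h (b j), fun h => b.ext h⟩

end LieAlgebraG33

/-! ### Characteristic polynomial of a matrix with zero last row. -/

section CharacteristicRoots

open Polynomial

/-- The characteristic polynomial is `X` times that of the upper left block. Allowing any square
root `r` of the discriminant avoids choosing a branch. -/
theorem Matrix.roots_charpoly_of_last_row_zero {A : Matrix (Fin 3) (Fin 3) ℝ}
    (hA : ∀ j, A 2 j = 0) {r : ℂ}
    (hr : r ^ 2 = (((A 0 0 - A 1 1) ^ 2 + 4 * A 0 1 * A 1 0 : ℝ) : ℂ)) :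
    (A.map (algebraMap ℝ ℂ)).charpoly.roots =
      {0, ((A 0 0 + A 1 1 : ℝ) - r) / 2, ((A 0 0 + A 1 1 : ℝ) + r) / 2} := by
  have h : (A.map (algebraMap ℝ ℂ)).charpoly =
      (({0, ((A 0 0 + A 1 1 : ℝ) - r) / 2, ((A 0 0 + A 1 1 : ℝ) + r) / 2} : Multiset ℂ).map
        fun z => X - C z).prod := by
    have hC := congrArg (C : ℂ → ℂ[X]) hr
    simp only [map_pow] at hC
    push_cast at hC
    have h4 : (C (4 : ℂ) : ℂ[X]) = 4 := C_ofNat 4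
    simp only [map_add, map_sub, map_mul, map_pow, h4] at hC
    have h2 : (C (2⁻¹ : ℂ) : ℂ[X]) * 2 = 1 := by
      rw [← C_ofNat, ← C_mul]
      norm_num
    rw [Matrix.charpoly, Matrix.det_fin_three]
    simp [hA, div_eq_mul_inv, -map_inv₀]
    linear_combination X * C 2⁻¹ ^ 2 * hC + (X ^ 2 * (C (A 0 0 : ℂ) + C (A 1 1 : ℂ)) -
      X * (C (A 0 0 : ℂ) * C (A 1 1 : ℂ) - C (A 0 1 : ℂ) * C (A 1 0 : ℂ)) *
        (2 * C 2⁻¹ + 1)) * h2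
  rw [h, Polynomial.roots_multiset_prod_X_sub_C]

theorem Complex.exists_sq_eq_ofReal_of_neg {d : ℝ} (hd : d < 0) :
    ∃ r : ℂ, r ^ 2 = d ∧ r.re = 0 := by
  refine ⟨(Real.sqrt (-d) : ℂ) * Complex.I, ?_, by simp⟩
  rw [mul_pow, Complex.I_sq, ← Complex.ofReal_pow, Real.sq_sqrt (by linarith)]
  simp

/-- Cayley–Hamilton: with zero trace the characteristic polynomial is `X³ - (d / 4) X`, where `d` is
the discriminant. -/
theorem Matrix.cube_eq_of_last_row_zero {A : Matrix (Fin 3) (Fin 3) ℝ}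
    (hA : ∀ j, A 2 j = 0) (htr : A 0 0 + A 1 1 = 0) :
    A * A * A = (((A 0 0 - A 1 1) ^ 2 + 4 * A 0 1 * A 1 0) / 4) • A := by
  have h11 : A 1 1 = -A 0 0 := by linarith
  ext i j
  fin_cases i <;> fin_cases j <;>
    simp [Matrix.mul_apply, Fin.sum_univ_three, hA, h11] <;> ring

end CharacteristicRoots

/-! ### A Rodrigues formula for the exponential. -/

section ExponentialOfCube

variable {𝔸 : Type*} [NormedRing 𝔸] [NormedAlgebra ℝ 𝔸] [CompleteSpace 𝔸]

/-- Both sides solve `y' = x * y` with `y 0 = 1`, and left multiplication by `x` is Lipschitz. -/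
theorem exp_smul_eq_of_cube_eq {x : 𝔸} {w : ℝ} (hw : w ≠ 0) (hx : x * x * x = -(w ^ 2) • x)
    (t : ℝ) :
    NormedSpace.exp (t • x) =
      1 + (Real.sin (w * t) / w) • x + ((1 - Real.cos (w * t)) / w ^ 2) • (x * x) := by
  have hlin : ∀ t : ℝ, HasDerivAt (fun t : ℝ => w * t) w t := fun t => by
    simpa using (hasDerivAt_id t).const_mul w
  refine congrFun (ODE_solution_unique_univ (v := fun _ y => x * y) (s := fun _ => Set.univ)
    (K := ‖x‖₊) (t₀ := 0) (f := fun t : ℝ => NormedSpace.exp (t • x))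
    (g := fun t : ℝ => 1 + (Real.sin (w * t) / w) • x + ((1 - Real.cos (w * t)) / w ^ 2) • (x * x))
    (fun _ => LipschitzWith.lipschitzOnWith (LipschitzWith.of_dist_le_mul fun y z => ?_))
    (fun t => ⟨hasDerivAt_exp_smul_const' x t, trivial⟩) (fun t => ⟨?_, trivial⟩) ?_) t
  · rw [dist_eq_norm, dist_eq_norm, ← mul_sub]
    exact norm_mul_le _ _
  · have h1 := (((hlin t).sin.div_const w).smul_const x).const_add 1
    have h2 := (((hlin t).cos.const_sub 1).div_const (w ^ 2)).smul_const (x * x)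
    refine (h1.add h2).congr_deriv ?_
    rw [mul_add, mul_add, mul_one, mul_smul_comm, mul_smul_comm, ← mul_assoc, hx, smul_smul]
    have e1 : Real.cos (w * t) * w / w = Real.cos (w * t) := by field_simp
    have e2 : -(-Real.sin (w * t) * w) / w ^ 2 = Real.sin (w * t) / w := by field_simp
    have e3 : (1 - Real.cos (w * t)) / w ^ 2 * -(w ^ 2) = Real.cos (w * t) - 1 := by
      field_simp
      ring
    rw [e1, e2, e3]
    module
  · simp

theorem exp_smul_eq_one_of_cube_eq {x : 𝔸} {w : ℝ} (hw : w ≠ 0)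
    (hx : x * x * x = -(w ^ 2) • x) : NormedSpace.exp ((2 * Real.pi / w) • x) = 1 := by
  have h : w * (2 * Real.pi / w) = 2 * Real.pi := by field_simp
  rw [exp_smul_eq_of_cube_eq hw hx, h]
  simp

end ExponentialOfCube

/-! ### Invariants and periodicity of `exp (t • D)`. -/

section FiniteDimensionalExponential

variable {E : Type*} [NormedAddCommGroup E] [NormedSpace ℝ E]

/-- A linear map that is invariant under `exp (t • D)` for small `t ≥ 0` vanishes on the
image of `D`. -/
theorem eq_zero_of_exp_smul_invariant [CompleteSpace E] {F : Type*} [NormedAddCommGroup F]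
    [NormedSpace ℝ F] {D : E →L[ℝ] E} {ℓ : E →L[ℝ] F} {ε : ℝ}
    (hε : 0 < ε) (h : ∀ t ∈ Set.Ico 0 ε, ∀ v, ℓ (NormedSpace.exp (t • D) v) = ℓ v) (v : E) :
    ℓ (D v) = 0 := by
  have h1 : HasDerivWithinAt (fun t : ℝ => ℓ (NormedSpace.exp (t • D) v))
      (ℓ (D (NormedSpace.exp ((0 : ℝ) • D) v))) (Set.Ici 0) 0 :=
    (ℓ.hasFDerivAt.comp_hasDerivAt (0 : ℝ) (hasDerivAt_exp_smul_apply D v 0)).hasDerivWithinAt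
  -- Invariance is known only for `t ≥ 0`, so right derivatives at `0` are compared.
  have h2 : HasDerivWithinAt (fun t : ℝ => ℓ (NormedSpace.exp (t • D) v)) 0 (Set.Ici 0) 0 := by
    refine (hasDerivWithinAt_const (0 : ℝ) (Set.Ici 0) (ℓ v)).congr_of_eventuallyEq ?_ (by simp)
    filter_upwards [self_mem_nhdsWithin, mem_nhdsWithin_of_mem_nhds (Iio_mem_nhds hε)] with t h0 h1
    exact h t ⟨h0, h1⟩ v
  simpa using (uniqueDiffWithinAt_Ici (0 : ℝ)).eq_deriv _ h1 h2

theorem exp_smul_eq_one_of_last_row_zero [FiniteDimensional ℝ E] (b : Module.Basis (Fin 3) ℝ E)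
    (D : E →L[ℝ] E) {A : Matrix (Fin 3) (Fin 3) ℝ} (hAD : A = LinearMap.toMatrix b b (D : E →ₗ[ℝ] E))
    (hA : ∀ j, A 2 j = 0) (htr : A 0 0 + A 1 1 = 0)
    (hdisc : (A 0 0 - A 1 1) ^ 2 + 4 * A 0 1 * A 1 0 < 0) :
    ∃ T : ℝ, 0 < T ∧ NormedSpace.exp (T • D) = 1 := by
  have : CompleteSpace E := FiniteDimensional.complete ℝ E
  set d := (A 0 0 - A 1 1) ^ 2 + 4 * A 0 1 * A 1 0 with hd
  have hd4 : 0 < -d / 4 := by linarith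
  have hw : 0 < Real.sqrt (-d / 4) := Real.sqrt_pos.2 hd4
  -- The nonzero eigenvalues are `±i w` with `w = √(-d / 4)`, so the period is `2π / w`.
  refine ⟨2 * Real.pi / Real.sqrt (-d / 4), by positivity,
    exp_smul_eq_one_of_cube_eq (x := D) hw.ne' ?_⟩
  have hcube := A.cube_eq_of_last_row_zero hA htr
  rw [← hd, hAD, ← LinearMap.toMatrix_mul, ← LinearMap.toMatrix_mul, ← map_smul] at hcube
  have h := (LinearMap.toMatrix b b).injective hcube
  rw [Real.sq_sqrt hd4.le]
  ext v
  have hv := LinearMap.congr_fun h v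
  simp only [Module.End.mul_apply, LinearMap.smul_apply, ContinuousLinearMap.coe_coe] at hv
  simp only [mul_apply_eq_comp, smul_apply, hv]
  congr 1
  ring

end FiniteDimensionalExponential

/-! ### Linear flows and their linearization at the identity. -/

section LinearFlowOnLieGroup

open Set

variable {E : Type*} [NormedAddCommGroup E] [NormedSpace ℝ E]
  {H : Type*} [TopologicalSpace H] {I : ModelWithCorners ℝ E H}
  {G : Type*} [TopologicalSpace G] [ChartedSpace H G] [Group G]
  {𝒳 : (g : G) → TangentSpace I g} {φ : ℝ → G → G}

theorem IsLieGroupAutomorphism.map_mul {f : G → G} (hf : IsLieGroupAutomorphism I f) (g h : G) :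
    f (g * h) = f g * f h := by
  obtain ⟨F, hF, -⟩ := hf
  simp [← hF]

theorem IsLieGroupAutomorphism.map_one {f : G → G} (hf : IsLieGroupAutomorphism I f) :
    f 1 = 1 := by
  simpa using hf.map_mul 1 1

theorem IsLieGroupAutomorphism.contMDiff {f : G → G} (hf : IsLieGroupAutomorphism I f) :
    ContMDiff I I ∞ f := by
  obtain ⟨F, hF, h, -⟩ := hf
  rwa [funext hF] at h

variable [LieGroup I ∞ G]

/-- Automorphisms fix `1`, so the integral curve through `1` is constant. -/
theorem IsLinearFlow.apply_one (h : IsLinearFlow I 𝒳 φ) : 𝒳 1 = 0 := by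
  have h1 : HasMFDerivAt 𝓘(ℝ, ℝ) I (fun t => φ t 1) 0 _ := h.isMIntegralCurve 1 0
  have h2 : (fun t => φ t 1) = fun _ => (1 : G) := funext fun t => (h.automorphism t).map_one
  rw [h2] at h1
  have h3 := hasMFDerivAt_unique h1 (hasMFDerivAt_const (1 : G) (0 : ℝ))
  have h4 : ∀ q : G, q = 1 → (1 : ℝ →L[ℝ] ℝ).smulRight (𝒳 q : E) = 0 → (𝒳 1 : E) = 0 := by
    rintro _ rfl h
    simpa using DFunLike.congr_fun h (1 : ℝ)
  exact h4 1 rfl h3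

theorem IsLinearFlow.flow_add [I.Boundaryless] [T2Space G] (h : IsLinearFlow I 𝒳 φ)
    (s t : ℝ) (g : G) : φ (s + t) g = φ s (φ t g) := by
  have : IsManifold I 1 G := IsManifold.of_le (n := ∞) (by simp)
  have h1 := (h.isMIntegralCurve g).comp_add t
  have h2 := isMIntegralCurve_Ioo_eq_of_contMDiff_boundaryless (t₀ := 0)
    (h.smooth.of_le (by simp)) h1 (h.isMIntegralCurve (φ t g)) (by simp [h.flow_zero])
  exact congrFun h2 s

/-- The linearization at `1` of a vector field on a Lie group, as a continuous linear map. -/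
noncomputable def linearization (𝒳 : (g : G) → TangentSpace I g) : E →L[ℝ] E :=
  fderiv ℝ (chartVectorField I 𝒳 1) (extChartAt I (1 : G) 1)

variable [CompleteSpace E]

theorem IsLinearFlow.associatedDerivation_apply [I.Boundaryless] (h : IsLinearFlow I 𝒳 φ)
    (v : GroupLieAlgebra I G) : associatedDerivation I 𝒳 v = linearization 𝒳 v := by
  have : IsManifold I 1 G := IsManifold.of_le (n := ∞) (by simp)
  have h1 := neg_mlieBracket_of_eq_zero (Y := mulInvariantVectorField v) h.apply_one
  have h2 : mulInvariantVectorField v (1 : G) = v := by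
    have : (fun z : G => 1 * z) = id := by ext; simp
    have h3 : (mfderiv I I (fun z : G => 1 * z) 1 : E →L[ℝ] E) = ContinuousLinearMap.id ℝ E := by
      rw [this]
      exact mfderiv_id
    exact DFunLike.congr_fun h3 v
  rw [h2] at h1
  exact h1

theorem IsLinearFlow.exists_hasMFDerivAt_exp [I.Boundaryless] [T2Space G]
    (h : IsLinearFlow I 𝒳 φ) :
    ∃ ε > 0, ∀ t ∈ Ico 0 ε,
      HasMFDerivAt I I (φ t) 1 (NormedSpace.exp (t • linearization 𝒳) : E →L[ℝ] E) :=
  hasMFDerivAt_flow_of_eq_zero h.smooth h.flow_zero h.isMIntegralCurve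
    (fun t => (h.automorphism t).contMDiff.continuous) h.apply_one
    fun t => (h.automorphism t).map_one

/-- The derivative at `1` of the time `t` map of a linear flow is the exponential of `t` times the
associated derivation. -/
theorem IsLinearFlow.hasMFDerivAt_exp [I.Boundaryless] [T2Space G] (h : IsLinearFlow I 𝒳 φ)
    {t : ℝ} (ht : 0 ≤ t) :
    HasMFDerivAt I I (φ t) 1 (NormedSpace.exp (t • linearization 𝒳) : E →L[ℝ] E) := by
  obtain ⟨ε, hε, hsmall⟩ := h.exists_hasMFDerivAt_exp
  obtain ⟨n, hn⟩ := exists_nat_gt (t / ε)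
  have hn0 : (0 : ℝ) < n := (div_nonneg ht hε.le).trans_lt hn
  -- The local result covers only times below `ε`; `φ t` is the `n`-fold iterate of `φ (t / n)`, and
  -- the chain rule multiplies the exponentials.
  have hs : t / n ∈ Ico 0 ε := ⟨by positivity, by
    rw [div_lt_iff₀ hε] at hn
    rw [div_lt_iff₀ hn0]
    linarith⟩
  have hmul : ∀ k : ℕ, HasMFDerivAt I I (φ (k * (t / n))) 1
      (NormedSpace.exp ((t / n) • linearization 𝒳) ^ k : E →L[ℝ] E) := by
    intro k
    induction k with
    | zero =>
      have : φ ((0 : ℕ) * (t / n)) = id := by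
        ext g
        simp [h.flow_zero]
      rw [this, pow_zero]
      exact hasMFDerivAt_id _
    | succ k ih =>
      have h1 : φ ((k + 1 : ℕ) * (t / n)) = φ (t / n) ∘ φ (k * (t / n)) := by
        ext g
        rw [Function.comp_apply, ← h.flow_add]
        congr 1
        push_cast
        ring
      have h2 : ∀ y : G, y = 1 → HasMFDerivAt I I (φ (t / n)) y
          (NormedSpace.exp ((t / n) • linearization 𝒳) : E →L[ℝ] E) := by
        rintro _ rfl
        exact hsmall _ hs
      rw [h1, pow_succ']
      exact (h2 _ (h.automorphism _).map_one).comp (1 : G) ih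
  have h1 := hmul n
  have h2 : (n : ℝ) * (t / n) = t := by field_simp
  have h3 : t • linearization 𝒳 = n • ((t / n) • linearization 𝒳) := by
    rw [← Nat.cast_smul_eq_nsmul ℝ, smul_smul, h2]
  rw [h2] at h1
  let _ : NormedAlgebra ℚ (E →L[ℝ] E) := NormedAlgebra.restrictScalars ℚ ℝ _
  rw [h3, NormedSpace.exp_nsmul]
  exact h1

/-- If the linearization of a linear flow on a connected Lie group has `exp (T • D) = 1`, then the
flow is periodic with period `T`. -/
theorem IsLinearFlow.apply_eq_self [I.Boundaryless] [T2Space G] [PreconnectedSpace G]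
    (h : IsLinearFlow I 𝒳 φ) {T : ℝ} (hT : 0 ≤ T)
    (hexp : NormedSpace.exp (T • linearization 𝒳) = (1 : E →L[ℝ] E)) (g : G) : φ T g = g := by
  have h1 := h.hasMFDerivAt_exp hT
  rw [hexp] at h1
  exact eq_id_of_hasMFDerivAt_one_id (h.automorphism T).contMDiff (h.automorphism T).map_mul h1 g

/-- For a trivial flow `exp (t • D) = 1` for small `t ≥ 0`; differentiating at `0` gives `D = 0`.
This is what supplies a non-fixed point. -/
theorem IsLinearFlow.linearization_eq_zero_of_forall_fixed [I.Boundaryless] [T2Space G]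
    (h : IsLinearFlow I 𝒳 φ) (hfix : ∀ t g, φ t g = g) :
    (linearization 𝒳 : E →L[ℝ] E) = 0 := by
  obtain ⟨ε, hε, hsmall⟩ := h.exists_hasMFDerivAt_exp
  ext v
  refine eq_zero_of_exp_smul_invariant (ℓ := ContinuousLinearMap.id ℝ E) hε (fun t ht w => ?_) v
  have h2 := hsmall t ht
  rw [show φ t = id from funext (hfix t)] at h2
  exact DFunLike.congr_fun (hasMFDerivAt_unique h2 (hasMFDerivAt_id _)) w

/-- The associated derivation of a linear flow on a group of type `𝔤_{3,3}` has its image in the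
derived algebra. -/
theorem IsLinearFlow.coord_two_associatedDerivation [I.Boundaryless] [T2Space G]
    (h : IsLinearFlow I 𝒳 φ) [FiniteDimensional ℝ E]
    {b : Module.Basis (Fin 3) ℝ (GroupLieAlgebra I G)} (hb : IsBasisOfTypeG33 b)
    (v : GroupLieAlgebra I G) : b.coord 2 (associatedDerivation I 𝒳 v) = 0 := by
  obtain ⟨ε, hε, hsmall⟩ := h.exists_hasMFDerivAt_exp
  let _ : NormedAlgebra ℚ (E →L[ℝ] E) := NormedAlgebra.restrictScalars ℚ ℝ _
  set ℓ : E →L[ℝ] ℝ := LinearMap.toContinuousLinearMap (b.coord 2 : E →ₗ[ℝ] ℝ) with hℓ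
  rw [h.associatedDerivation_apply]
  refine eq_zero_of_exp_smul_invariant (ℓ := ℓ) hε (fun t ht w => ?_) v
  set B : E →L[ℝ] E := NormedSpace.exp (t • linearization 𝒳) with hB
  have hinj : Function.Injective B := by
    have hinv : NormedSpace.exp (-(t • linearization 𝒳)) * B = 1 := by
      refine (NormedSpace.exp_add_of_commute
        (Commute.neg_left (Commute.refl (t • linearization 𝒳)))).symm.trans ?_
      simp
    exact Function.LeftInverse.injective
      (g := (NormedSpace.exp (-(t • linearization 𝒳)) : E →L[ℝ] E))
      fun x => DFunLike.congr_fun hinv x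
  exact hb.coord_two_map
    (A := (B.toLinearMap : E →ₗ[ℝ] E)) hinj ((h.automorphism t).map_lie (hsmall t ht)) w

end LinearFlowOnLieGroup

/-! ### Derivations, eigenvalues and periodic orbits combined. -/

theorem mainTheorem11
    {G : Type*} [TopologicalSpace G] [T2Space G] [SimplyConnectedSpace G]
    [ChartedSpace (EuclideanSpace ℝ (Fin 3)) G] [Group G] [LieGroup (𝓡 3) ∞ G]
    (b : Module.Basis (Fin 3) ℝ (GroupLieAlgebra (𝓡 3) G)) (hb : IsBasisOfTypeG33 b) :
    -- a linear map is a derivation iff the last row of its matrix is zero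
    (∀ δ : GroupLieAlgebra (𝓡 3) G →ₗ[ℝ] GroupLieAlgebra (𝓡 3) G,
      (∃ D : LieDerivation ℝ (GroupLieAlgebra (𝓡 3) G) (GroupLieAlgebra (𝓡 3) G),
          D.toLinearMap = δ) ↔
        ∀ j, LinearMap.toMatrix b b δ 2 j = 0) ∧
    -- the complex eigenvalues of a derivation, with multiplicity
    (∀ D : LieDerivation ℝ (GroupLieAlgebra (𝓡 3) G) (GroupLieAlgebra (𝓡 3) G),
      ∀ A : Matrix (Fin 3) (Fin 3) ℝ, A = LinearMap.toMatrix b b D.toLinearMap →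
      ∀ r : ℂ, r ^ 2 = (((A 0 0 - A 1 1) ^ 2 + 4 * A 0 1 * A 1 0 : ℝ) : ℂ) →
        (A.map (algebraMap ℝ ℂ)).charpoly.roots =
          {0, ((A 0 0 + A 1 1 : ℝ) - r) / 2, ((A 0 0 + A 1 1 : ℝ) + r) / 2}) ∧
    -- linear flows
    (∀ (𝒳 : (g : G) → TangentSpace (𝓡 3) g) (φ : ℝ → G → G), IsLinearFlow (𝓡 3) 𝒳 φ →
      ∀ A : Matrix (Fin 3) (Fin 3) ℝ,
      A = LinearMap.toMatrix b b (associatedDerivation (𝓡 3) 𝒳) →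
        (∀ j, A 2 j = 0) ∧
        (A 0 0 + A 1 1 = 0 → (A 0 0 - A 1 1) ^ 2 + 4 * A 0 1 * A 1 0 < 0 →
          (∀ μ ∈ (A.map (algebraMap ℝ ℂ)).charpoly.roots, μ ≠ 0 → μ.re = 0) ∧
          HasPeriodicOrbit φ)) := by
  have hlast : ∀ (𝒳 : (g : G) → TangentSpace (𝓡 3) g) (φ : ℝ → G → G),
      IsLinearFlow (𝓡 3) 𝒳 φ → ∀ j,
        LinearMap.toMatrix b b (associatedDerivation (𝓡 3) 𝒳) 2 j = 0 := fun 𝒳 φ hφ =>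
    (b.coord_comp_eq_zero_iff _ 2).1
      (LinearMap.ext fun v => hφ.coord_two_associatedDerivation hb v)
  refine ⟨fun δ => (hb.exists_lieDerivation_iff δ).trans (b.coord_comp_eq_zero_iff δ 2),
    fun D A hA r hr => ?_, fun 𝒳 φ hφ A hA => ?_⟩
  · refine Matrix.roots_charpoly_of_last_row_zero ?_ hr
    rw [hA]
    exact (b.coord_comp_eq_zero_iff _ 2).1 ((hb.exists_lieDerivation_iff _).1 ⟨D, rfl⟩)
  · have hA2 : ∀ j, A 2 j = 0 := by
      rw [hA]
      exact hlast 𝒳 φ hφ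
    refine ⟨hA2, fun htr hdisc => ⟨fun μ hμ _ => ?_, ?_⟩⟩
    · obtain ⟨r, hr, hre⟩ := Complex.exists_sq_eq_ofReal_of_neg hdisc
      rw [Matrix.roots_charpoly_of_last_row_zero hA2 hr, htr] at hμ
      simp only [Multiset.insert_eq_cons, Multiset.mem_cons, Multiset.mem_singleton] at hμ
      rcases hμ with rfl | rfl | rfl <;> simp [hre]
    · have hlin : associatedDerivation (𝓡 3) 𝒳 =
          ((linearization 𝒳 : EuclideanSpace ℝ (Fin 3) →L[ℝ] EuclideanSpace ℝ (Fin 3)) :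
            EuclideanSpace ℝ (Fin 3) →ₗ[ℝ] EuclideanSpace ℝ (Fin 3)) :=
        LinearMap.ext fun v => hφ.associatedDerivation_apply v
      obtain ⟨T, hT, hexp⟩ := exp_smul_eq_one_of_last_row_zero
        (E := EuclideanSpace ℝ (Fin 3)) b (linearization 𝒳) (hA.trans (by rw [hlin]; rfl))
        hA2 htr hdisc
      have hper := hφ.apply_eq_self hT.le hexp
      -- All orbits already have period `T`; only a non-fixed point is missing, and a trivial flow
      -- would make `A = 0`, against `hdisc`.
      by_cases hfix : ∀ t g, φ t g = g
      · have h0 := hφ.linearization_eq_zero_of_forall_fixed hfix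
        have hA0 : A = 0 := by
          rw [hA, hlin, h0]
          exact map_zero (LinearMap.toMatrix b b)
        simp [hA0] at hdisc
      · push Not at hfix
        obtain ⟨t, g, hg⟩ := hfix
        refine ⟨g, ⟨t, hg⟩, T, hT, fun s => ?_⟩
        rw [hφ.flow_add, hper]
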